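/- Let $K$ be a field, $\Sigma$ a finite alphabet, and $T$ the shift on $\Sigma^{\mathbb Z}$. A subshift is a non-empty closed shift-invariant set $X\subseteq\Sigma^{\mathbb Z}$. It is transitive if it has a dense shift-orbit, aperiodic if it contains a point $x$ with $T^n x\neq x$ for all $n\neq 0$, and minimal if it contains no non-empty proper subshift. A finite word is a factor of $X$ if it occurs as a subword of some point of $X$. The monomial algebra $A_X$ is the quotient of the free algebra $K\langle\Sigma\rangle$ by the ideal generated by all words that are not factors of $X$. The groupoid $\mathfrak G_X$ of the action is $\mathbb Z\times X$ (with $\mathbb Z$ discrete) with $(m_2,T^{m_1}x)\cdot(m_1,x)=(m_1+m_2,x)$. Its convolution algebra $K[\mathfrak G_X]$ consists of the continuous, compactly supported functions $\mathfrak G_X\to K$ ($K$ discrete), with product $(f_1\cdot f_2)(g)=\sum_h f_1(h)f_2(h^{-1}g)$ over all $h\in\mathfrak G_X$ for which $h^{-1}g$ is defined. A right module $M$ over a unital associative $K$-algebra $A$ is exhaustively amenable if for every finite-dimensional subspace $V\le A$, every $\varepsilon>0$ and every finite-dimensional subspace $W\le M$ there is a finite-dimensional subspace $L\le M$ with $W\subseteq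 L$ and $\dim_K LV<(1+\varepsilon)\dim_K L$, where $LV$ is the span of all products $lv$ with $l\in L$, $v\in V$. Theorem. Let $X$ be a transitive aperiodic subshift. If $A_X$ is exhaustively amenable as a right module over itself, then $K[\mathfrak G_X]$ is exhaustively amenable as a right module over itself. If $X$ is minimal, then every non-zero right $K[\mathfrak G_X]$-module is exhaustively amenable. -/

import Mathlib

open scoped MulOpposite

namespace ExhAmen

open SymbolicDynamics.FullShift

/-! ### Exhaustive amenability of right modules -/

section Amenability

variable {K A M : Type*} [Field K] [Ring A] [Algebra K A]
  [AddCommGroup M] [Module K M] [Module Aᵐᵒᵖ M]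

/-- For subspaces `L ≤ M` and `V ≤ A` of a right `A`-module `M` and of `A`, the subspace `L V`
of `M`, that is, the `K`-linear span of all products `l · v` with `l ∈ L` and `v ∈ V`. -/
def prodSpan (L : Submodule K M) (V : Submodule K A) : Submodule K M :=
  Submodule.span K {m | ∃ l ∈ L, ∃ v ∈ V, m = MulOpposite.op v • l}

/-- `L` is a `(V, ε)`-invariant subspace of the right `A`-module `M`:
it is finite-dimensional and `dim (L V) < (1 + ε) dim L`. -/
def IsInvariantSubspace (V : Submodule K A) (ε : ℝ) (L : Submodule K M) : Prop :=
  FiniteDimensional K L ∧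
    (Module.finrank K (prodSpan L V) : ℝ) < (1 + ε) * (Module.finrank K L : ℝ)

variable (K A M) in
/-- The right `A`-module `M` is exhaustively amenable. (A right `A`-module is a module over the
opposite ring, with `op a • m` standing for `m · a`.) -/
def IsExhaustivelyAmenable : Prop :=
  ∀ V : Submodule K A, FiniteDimensional K V → ∀ ε : ℝ, 0 < ε →
    ∀ W : Submodule K M, FiniteDimensional K W →
      ∃ L : Submodule K M, W ≤ L ∧ IsInvariantSubspace V ε L

end Amenability

/-! ### Subshifts -/

section Subshifts

variable {S : Type*} [TopologicalSpace S]

/-- A subshift is transitive if it has a dense shift-orbit. -/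
def IsTransitive (X : Subshift S ℤ) : Prop :=
  ∃ x ∈ X.carrier, X.carrier ⊆ closure (Set.range fun n : ℤ => shift n x)

/-- A subshift is minimal if it is non-empty and contains no non-empty proper subshift. -/
def IsMinimal (X : Subshift S ℤ) : Prop :=
  X.carrier.Nonempty ∧
    ∀ Y : Subshift S ℤ, Y.carrier.Nonempty → Y.carrier ⊆ X.carrier → Y.carrier = X.carrier

/-- A subshift is aperiodic if it contains a point that is not periodic. -/
def IsAperiodic (X : Subshift S ℤ) : Prop :=
  ∃ x ∈ X.carrier, ∀ n : ℤ, n ≠ 0 → shift n x ≠ x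

/-- The finite word `w` is a factor of the subshift `X`: it occurs in some point of `X`. -/
def IsFactor (X : Subshift S ℤ) (w : FreeMonoid S) : Prop :=
  ∃ x ∈ X.carrier, ∃ i : ℤ, ∀ (n : ℕ) (h : n < w.toList.length), w.toList[n] = x (i + n)

theorem IsFactor.left {X : Subshift S ℤ} {u v : FreeMonoid S} (h : IsFactor X (u * v)) :
    IsFactor X u := by
  obtain ⟨x, hx, i, hi⟩ := h
  refine ⟨x, hx, i, fun n hn => ?_⟩
  have := hi n (by simp only [FreeMonoid.toList_mul, List.length_append]; omega)
  simpa [FreeMonoid.toList_mul, List.getElem_append_left hn] using this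

theorem IsFactor.right {X : Subshift S ℤ} {u v : FreeMonoid S} (h : IsFactor X (u * v)) :
    IsFactor X v := by
  obtain ⟨x, hx, i, hi⟩ := h
  refine ⟨x, hx, i + u.toList.length, fun n hn => ?_⟩
  have := hi (u.toList.length + n)
    (by simp only [FreeMonoid.toList_mul, List.length_append]; omega)
  simpa [FreeMonoid.toList_mul, List.getElem_append_right, add_assoc] using this

end Subshifts

/-! ### The monomial algebra of a subshift -/

section Monomial

variable {S : Type*} [TopologicalSpace S] (K : Type*) [Field K] (X : Subshift S ℤ)

open Classical in
/-- The ideal of relations of the monomial algebra: those elements of the free algebra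
`K⟨S⟩ = K[FreeMonoid S]` in which no factor of `X` has a non-zero coefficient; in other words,
the linear span of the words that are not factors of `X`. -/
noncomputable def relationIdeal : TwoSidedIdeal (MonoidAlgebra K (FreeMonoid S)) :=
  TwoSidedIdeal.mk' {f | ∀ w, IsFactor X w → f.coeff w = 0}
    (fun _ _ => by simp)
    (fun {f g} hf hg w hw => by simp [hf w hw, hg w hw])
    (fun {f} hf w hw => by simp [hf w hw])
    (fun {f g} hg w hw => by
      rw [MonoidAlgebra.coeff_mul]
      refine Finset.sum_eq_zero fun a _ => Finset.sum_eq_zero fun b _ => ?_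
      dsimp only
      split_ifs with hab
      · subst hab
        rw [hg b hw.right, mul_zero]
      · rfl)
    (fun {f g} hf w hw => by
      rw [MonoidAlgebra.coeff_mul]
      refine Finset.sum_eq_zero fun a _ => Finset.sum_eq_zero fun b _ => ?_
      dsimp only
      split_ifs with hab
      · subst hab
        rw [hf a hw.left, zero_mul]
      · rfl)

theorem mem_relationIdeal {f : MonoidAlgebra K (FreeMonoid S)} :
    f ∈ relationIdeal K X ↔ ∀ w, IsFactor X w → f.coeff w = 0 :=
  TwoSidedIdeal.mem_mk' _ _ _ _ _ _ _

/-- The relation ideal is the two-sided ideal generated by the words that are not factors. -/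
theorem relationIdeal_eq_span : relationIdeal K X =
    TwoSidedIdeal.span {f | ∃ w, ¬ IsFactor X w ∧ f = MonoidAlgebra.of K (FreeMonoid S) w} := by
  apply le_antisymm
  · intro f hf
    rw [mem_relationIdeal] at hf
    rw [← MonoidAlgebra.sum_coeff_single f]
    refine sum_mem fun w hw => ?_
    have hs : MonoidAlgebra.single w (f.coeff w) =
        algebraMap K _ (f.coeff w) * MonoidAlgebra.of K (FreeMonoid S) w := by
      rw [← Algebra.smul_def]
      simp
    simp only [hs]
    exact TwoSidedIdeal.mul_mem_left _ _ _ (TwoSidedIdeal.subset_span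
      ⟨w, fun h => Finsupp.mem_support_iff.1 hw (hf w h), rfl⟩)
  · rw [TwoSidedIdeal.span_le]
    rintro _ ⟨w, hw, rfl⟩
    rw [SetLike.mem_coe, mem_relationIdeal]
    intro v hv
    have : w ≠ v := fun h => hw (h ▸ hv)
    simp [this]

/-- The monomial algebra `A_X` over `K`: the quotient of the free algebra on the alphabet by the
words that are not factors of `X`. It is spanned by the factors of `X`, multiplied by
concatenation, a product that is not a factor being zero. -/
abbrev MonomialAlgebra : Type _ := (relationIdeal K X).ringCon.Quotient

end Monomial

/-! ### The groupoid of the shift action and its convolution algebra -/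

section Groupoid

variable {S : Type*} [TopologicalSpace S]

/-- The power `T ^ n` of the shift `T`, acting on the points of the subshift `X`. -/
def shiftPow {X : Subshift S ℤ} (n : ℤ) (x : X.carrier) : X.carrier :=
  ⟨shift n x.1, X.mapsTo n x.2⟩

/-- The groupoid `𝔊_X` of the action of `ℤ` on `X`, with its topology as the product of the
discrete space `ℤ` and the space `X`. -/
abbrev ActionGroupoid (X : Subshift S ℤ) : Type _ := ℤ × X.carrier

namespace ActionGroupoid

variable {X : Subshift S ℤ}

/-- The source of `(m, x)` is `x`. -/
def source (g : ActionGroupoid X) : X.carrier := g.2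

/-- The target of `(m, x)` is `T ^ m x`. -/
def target (g : ActionGroupoid X) : X.carrier := shiftPow g.1 g.2

/-- The inverse of `(m, x)` is `(-m, T ^ m x)`. -/
def inv (g : ActionGroupoid X) : ActionGroupoid X := (-g.1, shiftPow g.1 g.2)

/-- The product `(m₂, T ^ m₁ x) · (m₁, x) = (m₁ + m₂, x)` of the groupoid. It is meaningful when
the source of the left factor is the target of the right factor. -/
def comp (h g : ActionGroupoid X) : ActionGroupoid X := (g.1 + h.1, g.2)

end ActionGroupoid

variable {K : Type*} [Field K] {X : Subshift S ℤ}

/-- The convolution `(f₁ * f₂) g = ∑ f₁ h * f₂ (h⁻¹ g)`, summed over all `h` in the groupoid for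
which `h⁻¹ g` is defined, that is, for which the source of `h⁻¹`, which is the target of `h`,
equals the target of `g`. (The sum has finitely many non-zero terms if `f₂` has
compact support.) -/
noncomputable def convolution (f₁ f₂ : ActionGroupoid X → K) (g : ActionGroupoid X) : K :=
  ∑ᶠ (h : ActionGroupoid X) (_ : h ∈ {h : ActionGroupoid X | h.target = g.target}),
    f₁ h * f₂ (h.inv.comp g)

variable (K X) in
/-- The space of continuous (for the discrete topology of `K`, so locally constant), compactly
supported functions from the groupoid to `K`. -/
def compactlySupported : Submodule K (ActionGroupoid X → K) where
  carrier := {f | IsLocallyConstant f ∧ HasCompactSupport f}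
  add_mem' hf hg := ⟨hf.1.add hg.1, hf.2.add hg.2⟩
  zero_mem' := ⟨IsLocallyConstant.const 0, HasCompactSupport.zero⟩
  smul_mem' c _ hf := ⟨hf.1.comp (c • ·), hf.2.comp_left (smul_zero c)⟩

theorem shiftPow_zero (x : X.carrier) : shiftPow 0 x = x :=
  Subtype.ext (shift_zero _)

theorem shiftPow_shiftPow (m n : ℤ) (x : X.carrier) :
    shiftPow m (shiftPow n x) = shiftPow (m + n) x :=
  Subtype.ext (by rw [add_comm]; exact (shift_add n m x.1).symm)

theorem continuous_shiftPow (n : ℤ) : Continuous (shiftPow n : X.carrier → X.carrier) :=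
  ((continuous_shift n).comp continuous_subtype_val).subtype_mk _

theorem convolution_apply (f₁ f₂ : ActionGroupoid X → K) (m : ℤ) (x : X.carrier) :
    convolution f₁ f₂ (m, x) = ∑ᶠ k : ℤ, f₁ (m - k, shiftPow k x) * f₂ (k, x) := by
  let φ : ℤ → ActionGroupoid X := fun k => (m - k, shiftPow k x)
  have hφ : Function.Injective φ := fun a b h => by
    have := congrArg Prod.fst h
    simp only [φ] at this
    omega
  have hr : {h : ActionGroupoid X | h.target = ActionGroupoid.target (m, x)} = Set.range φ := by
    ext ⟨a, y⟩
    simp only [Set.mem_ofPred_eq, Set.mem_range, ActionGroupoid.target, φ, Prod.mk.injEq]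
    constructor
    · intro h
      refine ⟨m - a, by omega, ?_⟩
      have := congrArg (shiftPow (-a)) h
      rw [shiftPow_shiftPow, shiftPow_shiftPow, neg_add_cancel, shiftPow_zero] at this
      rw [this, neg_add_eq_sub]
    · rintro ⟨k, rfl, rfl⟩
      rw [shiftPow_shiftPow, sub_add_cancel]
  rw [convolution, hr, finsum_mem_range hφ]
  refine finsum_congr fun k => ?_
  simp only [φ, ActionGroupoid.inv, ActionGroupoid.comp]
  congr 3
  omega

theorem convolution_eq_sum (f₁ f₂ : ActionGroupoid X → K) (s : Finset ℤ)
    (hs : ∀ k ∉ s, ∀ x, f₂ (k, x) = 0) (m : ℤ) (x : X.carrier) :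
    convolution f₁ f₂ (m, x) = ∑ k ∈ s, f₁ (m - k, shiftPow k x) * f₂ (k, x) := by
  rw [convolution_apply]
  refine finsum_eq_sum_of_support_subset _ fun k hk => ?_
  by_contra h
  exact hk (by simp only [hs k h, mul_zero])

theorem exists_degrees {f : ActionGroupoid X → K} (hf : f ∈ compactlySupported K X) :
    ∃ s : Finset ℤ, ∀ k ∉ s, ∀ x, f (k, x) = 0 := by
  have h : (Prod.fst '' tsupport f).Finite := (hf.2.image continuous_fst).finite_of_discrete
  refine ⟨h.toFinset, fun k hk x => ?_⟩
  by_contra h0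
  exact hk (h.mem_toFinset.2 ⟨(k, x), subset_tsupport f h0, rfl⟩)

variable [DiscreteTopology S] [Finite S]

theorem mem_compactlySupported_of_degrees {f : ActionGroupoid X → K} (hf : IsLocallyConstant f)
    (s : Finset ℤ) (hs : ∀ k ∉ s, ∀ x, f (k, x) = 0) : f ∈ compactlySupported K X := by
  have : CompactSpace X.carrier := isCompact_iff_compactSpace.1 X.isClosed.isCompact
  refine ⟨hf, HasCompactSupport.intro (K := (s : Set ℤ) ×ˢ Set.univ)
    (s.finite_toSet.isCompact.prod isCompact_univ) ?_⟩
  rintro ⟨k, x⟩ hk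
  exact hs k (fun h => hk ⟨h, trivial⟩) x

theorem convolution_mem {f₁ f₂ : ActionGroupoid X → K} (h₁ : f₁ ∈ compactlySupported K X)
    (h₂ : f₂ ∈ compactlySupported K X) : convolution f₁ f₂ ∈ compactlySupported K X := by
  obtain ⟨s₁, hs₁⟩ := exists_degrees h₁
  obtain ⟨s₂, hs₂⟩ := exists_degrees h₂
  classical
  refine mem_compactlySupported_of_degrees ?_ (Finset.image₂ (· + ·) s₁ s₂) ?_
  · have he : convolution f₁ f₂ = ∑ k ∈ s₂, fun g : ActionGroupoid X =>
        f₁ (g.1 - k, shiftPow k g.2) * f₂ (k, g.2) := by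
      funext ⟨m, x⟩
      rw [convolution_eq_sum f₁ f₂ s₂ hs₂, Finset.sum_apply]
    rw [he]
    refine Finset.sum_induction _ IsLocallyConstant (fun _ _ ha hb => ha.add hb)
      (IsLocallyConstant.const 0) fun k _ => ?_
    refine (h₁.1.comp_continuous (f := fun g : ActionGroupoid X => (g.1 - k, shiftPow k g.2))
      ?_).mul (h₂.1.comp_continuous (f := fun g : ActionGroupoid X => (k, g.2)) ?_)
    · exact (continuous_fst.sub continuous_const).prodMk
        ((continuous_shiftPow k).comp continuous_snd)
    · exact continuous_const.prodMk continuous_snd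
  · intro m hm x
    rw [convolution_eq_sum f₁ f₂ s₂ hs₂]
    refine Finset.sum_eq_zero fun k hk => ?_
    rw [hs₁ (m - k) (fun h => hm (Finset.mem_image₂.2 ⟨m - k, h, k, hk, sub_add_cancel m k⟩)),
      zero_mul]

/-- The unit of the convolution algebra: the characteristic function of the space of units
`{0} × X` of the groupoid. -/
def unitFun : ActionGroupoid X → K := fun g => if g.1 = 0 then 1 else 0

theorem unitFun_mem : (unitFun : ActionGroupoid X → K) ∈ compactlySupported K X := by
  refine mem_compactlySupported_of_degrees ?_ {0} ?_
  · exact (IsLocallyConstant.of_discrete fun n : ℤ => if n = 0 then (1 : K) else 0).comp_continuous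
      (f := fun g : ActionGroupoid X => g.1) continuous_fst
  · intro k hk x
    simp only [Finset.mem_singleton] at hk
    simp [unitFun, hk]

theorem convolution_assoc {f₁ f₂ f₃ : ActionGroupoid X → K}
    (h₂ : f₂ ∈ compactlySupported K X) (h₃ : f₃ ∈ compactlySupported K X) :
    convolution (convolution f₁ f₂) f₃ = convolution f₁ (convolution f₂ f₃) := by
  obtain ⟨s₂, hs₂⟩ := exists_degrees h₂
  obtain ⟨s₃, hs₃⟩ := exists_degrees h₃
  obtain ⟨s, hs⟩ := exists_degrees (convolution_mem h₂ h₃)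
  classical
  funext ⟨m, x⟩
  let t : Finset ℤ := s ∪ Finset.image₂ (· + ·) s₂ s₃
  rw [convolution_eq_sum _ _ s₃ hs₃, convolution_eq_sum _ _ t
    (fun k hk => hs k fun h => hk (Finset.mem_union_left _ h))]
  simp_rw [convolution_eq_sum _ _ s₂ hs₂, convolution_eq_sum _ _ s₃ hs₃, Finset.sum_mul,
    Finset.mul_sum]
  rw [Finset.sum_comm (s := t)]
  refine Finset.sum_congr rfl fun a ha => ?_
  have himg : s₂.image (· + a) ⊆ t := by
    intro c hc
    obtain ⟨b, hb, rfl⟩ := Finset.mem_image.1 hc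
    exact Finset.mem_union_right _ (Finset.mem_image₂.2 ⟨b, hb, a, ha, rfl⟩)
  rw [← Finset.sum_subset himg, Finset.sum_image (fun _ _ _ _ h => add_right_cancel h)]
  · refine Finset.sum_congr rfl fun b _ => ?_
    rw [shiftPow_shiftPow, add_sub_cancel_right, sub_sub, add_comm a b, mul_assoc]
  · intro c _ hc
    rw [hs₂ (c - a) (fun h => hc (Finset.mem_image.2 ⟨c - a, h, sub_add_cancel c a⟩)), zero_mul,
      mul_zero]

variable (K X) in
/-- The convolution algebra `K[𝔊_X]`: continuous compactly supported functions from the groupoid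
of the shift action to the discrete field `K`, with convolution as multiplication. -/
def ConvolutionAlgebra : Type _ := compactlySupported K X

set_option linter.unusedSectionVars false

namespace ConvolutionAlgebra

noncomputable instance : AddCommGroup (ConvolutionAlgebra K X) :=
  inferInstanceAs (AddCommGroup (compactlySupported K X))

noncomputable instance : Module K (ConvolutionAlgebra K X) :=
  inferInstanceAs (Module K (compactlySupported K X))

noncomputable instance : Mul (ConvolutionAlgebra K X) :=
  ⟨fun f₁ f₂ => ⟨convolution f₁.1 f₂.1, convolution_mem f₁.2 f₂.2⟩⟩

noncomputable instance : One (ConvolutionAlgebra K X) := ⟨⟨unitFun, unitFun_mem⟩⟩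

theorem ext {f g : ConvolutionAlgebra K X} (h : ∀ m x, f.1 (m, x) = g.1 (m, x)) : f = g :=
  Subtype.ext (funext fun p => h p.1 p.2)

theorem zero_val : (0 : ConvolutionAlgebra K X).1 = 0 := rfl

theorem add_val (f g : ConvolutionAlgebra K X) : (f + g).1 = f.1 + g.1 := rfl

theorem smul_val (c : K) (f : ConvolutionAlgebra K X) : (c • f).1 = c • f.1 := rfl

theorem mul_val (f g : ConvolutionAlgebra K X) : (f * g).1 = convolution f.1 g.1 := rfl

theorem one_val : (1 : ConvolutionAlgebra K X).1 = unitFun := rfl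

noncomputable instance : Ring (ConvolutionAlgebra K X) :=
  { (inferInstance : AddCommGroup (ConvolutionAlgebra K X)),
    (inferInstance : Mul (ConvolutionAlgebra K X)),
    (inferInstance : One (ConvolutionAlgebra K X)) with
    left_distrib := fun f g h => ext fun m x => by
      obtain ⟨s, hs⟩ := exists_degrees g.2
      obtain ⟨t, ht⟩ := exists_degrees h.2
      classical
      have hs' : ∀ k ∉ s ∪ t, ∀ x, g.1 (k, x) = 0 :=
        fun k hk => hs k fun h => hk (Finset.mem_union_left _ h)
      have ht' : ∀ k ∉ s ∪ t, ∀ x, h.1 (k, x) = 0 :=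
        fun k hk => ht k fun h => hk (Finset.mem_union_right _ h)
      rw [add_val, Pi.add_apply]
      simp only [mul_val]
      rw [convolution_eq_sum _ _ _ hs', convolution_eq_sum _ _ _ ht',
        convolution_eq_sum _ _ (s ∪ t) (fun k hk x => by
          rw [add_val, Pi.add_apply, hs' k hk, ht' k hk, add_zero]), ← Finset.sum_add_distrib]
      exact Finset.sum_congr rfl fun k _ => mul_add _ _ _
    right_distrib := fun f g h => ext fun m x => by
      obtain ⟨s, hs⟩ := exists_degrees h.2
      rw [add_val, Pi.add_apply]
      simp only [mul_val]
      rw [convolution_eq_sum _ _ _ hs, convolution_eq_sum _ _ _ hs,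
        convolution_eq_sum _ _ _ hs, ← Finset.sum_add_distrib]
      exact Finset.sum_congr rfl fun k _ => add_mul _ _ _
    zero_mul := fun f => ext fun m x => by
      rw [mul_val, convolution_apply, zero_val]
      simp
    mul_zero := fun f => ext fun m x => by
      rw [mul_val, convolution_apply, zero_val]
      simp
    mul_assoc := fun f g h => Subtype.ext (convolution_assoc g.2 h.2)
    one_mul := fun f => ext fun m x => by
      rw [mul_val, convolution_apply, one_val, finsum_eq_single _ m]
      · simp [unitFun]
      · intro k hk
        simp [unitFun, sub_eq_zero, hk.symm]
    mul_one := fun f => ext fun m x => by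
      rw [mul_val, convolution_apply, one_val, finsum_eq_single _ 0]
      · simp [unitFun, shiftPow_zero]
      · intro k hk
        simp [unitFun, hk] }

noncomputable instance : Algebra K (ConvolutionAlgebra K X) :=
  Algebra.ofModule
    (fun c f g => ext fun m x => by
      obtain ⟨s, hs⟩ := exists_degrees g.2
      rw [smul_val, Pi.smul_apply, mul_val, mul_val, convolution_eq_sum _ _ _ hs,
        convolution_eq_sum _ _ _ hs, Finset.smul_sum]
      exact Finset.sum_congr rfl fun k _ => smul_mul_assoc c _ _)
    (fun c f g => ext fun m x => by
      obtain ⟨s, hs⟩ := exists_degrees g.2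
      rw [smul_val, Pi.smul_apply, mul_val, mul_val, convolution_eq_sum _ _ _ hs,
        convolution_eq_sum _ _ s (fun k hk x => by
          rw [smul_val, Pi.smul_apply, hs k hk, smul_zero]), Finset.smul_sum]
      exact Finset.sum_congr rfl fun k _ => mul_smul_comm c _ _)

end ConvolutionAlgebra

end Groupoid

end ExhAmen

/-!
Write `A` for the convolution algebra, `T ^ i` for the characteristic function of `{i} × X` and
`e_U` for that of `{0} × U`, where `U` is a clopen set of points. Every element of `A` is a finite
sum of terms `T ^ k b` with `b` a locally constant function on `X`.

Fix a point `x₀` with infinite orbit, a finite-dimensional `V ≤ A` whose elements have degrees in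
`[-N, N]`, and a height `n`. A small clopen neighbourhood `U` of `x₀` is the base of a tower: its
first `n` translates are pairwise disjoint, and the finitely many coefficients of a spanning set
of `V` are constant on every translate that matters (`exists_isClopen_tower`). Let `M` be a right
`A`-module and `m ∈ M` a non-zero element with `m e_U = m`. Since the translates are disjoint,
`m, m T, …, m T ^ (n - 1)` are linearly independent (`linearIndependent_level`). Since the
coefficients are constant on the translates, `m T ^ i v` is a combination of the elements
`m T ^ (i + k)` with `|k| ≤ N` (`op_smul_level_mem`). So the span `F` of the first `n` levels has
dimension `n`, while `F V` has dimension at most `n + 2 N`. For a given finite-dimensional `W ≤ M`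
the dimension of `W V` is bounded independently of `n`, and `F + W` is almost invariant as soon as
`n` is large. Thus `M` is exhaustively amenable if such an element `m` exists for every `U`
(`isExhaustivelyAmenable_of_forall_isClopen`): the amenability of `ℤ` is all that is at work.

For `M = A` one takes `m = e_U`, which is non-zero because `x₀ ∈ U`. If `X` is minimal, then
finitely many translates of `U` cover `X`, so an element of `M` killed by the idempotents of all
translates `T ^ n U`, which are `T ^ n e_U T ^ (-n)`, is zero; hence `m' T ^ n e_U ≠ 0` for every
non-zero `m'` and some `n`, and this element can be taken for `m`
(`IsMinimal.exists_cutoff_smul_eq`).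
-/

namespace ExhAmen

open SymbolicDynamics.FullShift Topology

/-! ### Finite-dimensionality of products of subspaces -/

section ProdSpan

variable {K A M : Type*} [Field K] [Ring A] [Algebra K A]
  [AddCommGroup M] [Module K M] [Module Aᵐᵒᵖ M]

theorem prodSpan_le {L : Submodule K M} {V : Submodule K A} {N : Submodule K M} :
    prodSpan L V ≤ N ↔ ∀ l ∈ L, ∀ v ∈ V, MulOpposite.op v • l ∈ N := by
  rw [prodSpan, Submodule.span_le]
  constructor
  · exact fun h l hl v hv => h ⟨l, hl, v, hv, rfl⟩
  · rintro h _ ⟨l, hl, v, hv, rfl⟩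
    exact h l hl v hv

theorem op_smul_mem_prodSpan {L : Submodule K M} {V : Submodule K A} {l : M} {v : A}
    (hl : l ∈ L) (hv : v ∈ V) : MulOpposite.op v • l ∈ prodSpan L V :=
  Submodule.subset_span ⟨l, hl, v, hv, rfl⟩

variable [IsScalarTower K Aᵐᵒᵖ M]

theorem op_smul_smul_comm (c : K) (a : A) (m : M) :
    MulOpposite.op a • (c • m) = c • (MulOpposite.op a • m) :=
  have : SMulCommClass Aᵐᵒᵖ K M := IsScalarTower.to_smulCommClass'
  smul_comm _ _ _

theorem finiteDimensional_prodSpan (L : Submodule K M) (V : Submodule K A)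
    [FiniteDimensional K L] [FiniteDimensional K V] : FiniteDimensional K (prodSpan L V) := by
  let B : M →ₗ[K] A →ₗ[K] M := LinearMap.mk₂ K (fun m a => MulOpposite.op a • m)
    (fun _ _ _ => smul_add _ _ _) (fun c m a => op_smul_smul_comm c a m)
    (fun m a b => by rw [MulOpposite.op_add, add_smul])
    (fun c m a => by rw [MulOpposite.op_smul, smul_assoc])
  have hfg : (Submodule.map₂ B L V).FG :=
    Submodule.FG.map₂ B (Submodule.fg_iff_finiteDimensional L |>.2 ‹_›)
      (Submodule.fg_iff_finiteDimensional V |>.2 ‹_›)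
  have : FiniteDimensional K (Submodule.map₂ B L V) :=
    (Submodule.fg_iff_finiteDimensional _).1 hfg
  exact Submodule.finiteDimensional_of_le
    (prodSpan_le.2 fun l hl v hv => Submodule.apply_mem_map₂ B hl hv)

end ProdSpan

/-! ### Homogeneous elements of the convolution algebra -/

section Homogeneous

variable {S : Type*} [TopologicalSpace S] [DiscreteTopology S] [Finite S]
  {K : Type*} [Field K] {X : Subshift S ℤ}

/-- The element `(k, x) ↦ b x` for `k = n`, and `0` for `k ≠ n`, of the convolution algebra. -/
noncomputable def homogeneous (n : ℤ) (b : LocallyConstant X.carrier K) :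
    ConvolutionAlgebra K X :=
  ⟨fun g => if g.1 = n then b g.2 else 0, by
    refine mem_compactlySupported_of_degrees ?_ {n} fun k hk x => if_neg (by simpa using hk)
    have h₁ : IsLocallyConstant fun g : ActionGroupoid X => if g.1 = n then (1 : K) else 0 :=
      (IsLocallyConstant.of_discrete fun k : ℤ => if k = n then (1 : K) else 0).comp_continuous
        (f := fun g : ActionGroupoid X => g.1) continuous_fst
    have h₂ : IsLocallyConstant fun g : ActionGroupoid X => b g.2 :=
      b.isLocallyConstant.comp_continuous (f := fun g : ActionGroupoid X => g.2) continuous_snd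
    convert h₁.mul h₂ using 2 with g
    simp⟩

theorem homogeneous_val (n : ℤ) (b : LocallyConstant X.carrier K) (k : ℤ) (x : X.carrier) :
    (homogeneous n b).1 (k, x) = if k = n then b x else 0 := rfl

theorem homogeneous_mul_val (n : ℤ) (b : LocallyConstant X.carrier K)
    (f : ConvolutionAlgebra K X) (k : ℤ) (x : X.carrier) :
    (homogeneous n b * f).1 (k, x) = b (shiftPow (k - n) x) * f.1 (k - n, x) := by
  rw [ConvolutionAlgebra.mul_val, convolution_apply, finsum_eq_single _ (k - n)]
  · rw [homogeneous_val, if_pos (sub_sub_cancel k n)]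
  · intro j hj
    rw [homogeneous_val, if_neg (by omega), zero_mul]

variable (K X) in
/-- The unit `T ^ n` of the convolution algebra: the characteristic function of `{n} × X`. -/
noncomputable def shiftUnit (n : ℤ) : ConvolutionAlgebra K X := homogeneous n 1

theorem shiftUnit_mul_val (n : ℤ) (f : ConvolutionAlgebra K X) (k : ℤ) (x : X.carrier) :
    (shiftUnit K X n * f).1 (k, x) = f.1 (k - n, x) := by
  rw [shiftUnit, homogeneous_mul_val, LocallyConstant.coe_one, Pi.one_apply, one_mul]

theorem shiftUnit_zero : shiftUnit K X 0 = 1 := rfl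

theorem shiftUnit_mul_shiftUnit (m n : ℤ) :
    shiftUnit K X m * shiftUnit K X n = shiftUnit K X (m + n) := by
  refine ConvolutionAlgebra.ext fun k x => ?_
  rw [shiftUnit_mul_val, shiftUnit, shiftUnit, homogeneous_val, homogeneous_val]
  simp only [sub_eq_iff_eq_add, add_comm n m]

variable (K) in
/-- The idempotent of the convolution algebra attached to a clopen set `U` of points: the
characteristic function of `{0} × U`. -/
noncomputable def cutoff {U : Set X.carrier} (hU : IsClopen U) : ConvolutionAlgebra K X :=
  homogeneous 0 (LocallyConstant.charFn K hU)

open Classical in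
theorem cutoff_val {U : Set X.carrier} (hU : IsClopen U) (k : ℤ) (x : X.carrier) :
    (cutoff K hU).1 (k, x) = if k = 0 ∧ x ∈ U then 1 else 0 := by
  rw [cutoff, homogeneous_val, LocallyConstant.coe_charFn, Set.indicator_apply, ite_and]
  rfl

open Classical in
theorem cutoff_mul_val {U : Set X.carrier} (hU : IsClopen U) (f : ConvolutionAlgebra K X)
    (k : ℤ) (x : X.carrier) :
    (cutoff K hU * f).1 (k, x) = if shiftPow k x ∈ U then f.1 (k, x) else 0 := by
  rw [cutoff, homogeneous_mul_val, sub_zero, LocallyConstant.coe_charFn, Set.indicator_apply,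
    Pi.one_apply, ite_mul, one_mul, zero_mul]

theorem cutoff_mul_cutoff {U V : Set X.carrier} (hU : IsClopen U) (hV : IsClopen V) :
    cutoff K hU * cutoff K hV = cutoff K (hU.inter hV) := by
  refine ConvolutionAlgebra.ext fun k x => ?_
  rw [cutoff_mul_val, cutoff_val, cutoff_val]
  by_cases hk : k = 0
  · subst hk
    rw [shiftPow_zero]
    by_cases h₁ : x ∈ U <;> by_cases h₂ : x ∈ V <;> simp [h₁, h₂]
  · simp [hk]

theorem cutoff_mul_self {U : Set X.carrier} (hU : IsClopen U) :
    cutoff K hU * cutoff K hU = cutoff K hU := by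
  rw [cutoff_mul_cutoff]
  congr 1
  exact Set.inter_self U

theorem cutoff_union {U V : Set X.carrier} (hU : IsClopen U) (hV : IsClopen V) :
    cutoff K (hU.union hV) = cutoff K hU + cutoff K hV - cutoff K hU * cutoff K hV := by
  rw [cutoff_mul_cutoff, eq_sub_iff_add_eq]
  refine ConvolutionAlgebra.ext fun k x => ?_
  simp only [ConvolutionAlgebra.add_val, Pi.add_apply, cutoff_val, Set.mem_union,
    Set.mem_inter_iff]
  by_cases hk : k = 0 <;> by_cases h₁ : x ∈ U <;> by_cases h₂ : x ∈ V <;> simp [hk, h₁, h₂]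

theorem cutoff_univ : cutoff K (isClopen_univ : IsClopen (Set.univ : Set X.carrier)) = 1 := by
  refine ConvolutionAlgebra.ext fun k x => ?_
  rw [cutoff_val, ConvolutionAlgebra.one_val, unitFun]
  simp

theorem cutoff_empty : cutoff K (isClopen_empty : IsClopen (∅ : Set X.carrier)) = 0 := by
  refine ConvolutionAlgebra.ext fun k x => ?_
  rw [cutoff_val, ConvolutionAlgebra.zero_val]
  simp

/-- Conjugating the idempotent of `U` by a power of the shift moves `U`. -/
theorem shiftUnit_mul_cutoff_mul_shiftUnit {U : Set X.carrier} (hU : IsClopen U) (n : ℤ) :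
    shiftUnit K X n * (cutoff K hU * shiftUnit K X (-n)) =
      cutoff K (hU.preimage (continuous_shiftPow (-n))) := by
  refine ConvolutionAlgebra.ext fun k x => ?_
  rw [shiftUnit_mul_val, cutoff_mul_val, cutoff_val, shiftUnit, homogeneous_val]
  by_cases hk : k = 0
  · subst hk
    rw [zero_sub, if_pos rfl]
    by_cases h : shiftPow (-n) x ∈ U <;> simp [h]
  · rw [if_neg (not_and.2 fun h => absurd h hk), if_neg (show k - n ≠ -n by omega), ite_self]

theorem cutoff_mul_shiftUnit_mul_cutoff {U : Set X.carrier} (hU : IsClopen U) (n : ℤ)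
    (h : ∀ x ∈ U, shiftPow n x ∉ U) :
    cutoff K hU * (shiftUnit K X n * cutoff K hU) = 0 := by
  refine ConvolutionAlgebra.ext fun k x => ?_
  rw [cutoff_mul_val, shiftUnit_mul_val, cutoff_val, ConvolutionAlgebra.zero_val, Pi.zero_apply]
  split_ifs with h₁ h₂
  · obtain rfl : k = n := by omega
    exact absurd h₁ (h x h₂.2)
  · rfl
  · rfl

/-- If the coefficients of `v` are constant on the relevant translates of `U`, then `e_U T ^ i v`
is `e_U` times a linear combination of powers of the shift. -/
theorem cutoff_mul_shiftUnit_mul {U : Set X.carrier} (hU : IsClopen U) (i : ℤ)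
    (v : ConvolutionAlgebra K X) (s : Finset ℤ) (hs : ∀ k ∉ s, ∀ x, v.1 (k, x) = 0)
    (x₀ : X.carrier) (hv : ∀ k ∈ s, ∀ y ∈ U,
      v.1 (k, shiftPow (-(i + k)) y) = v.1 (k, shiftPow (-(i + k)) x₀)) :
    cutoff K hU * (shiftUnit K X i * v) =
      cutoff K hU * ∑ k ∈ s, v.1 (k, shiftPow (-(i + k)) x₀) • shiftUnit K X (i + k) := by
  have hsum : ∀ (t : Finset ℤ) (c : ℤ → K) (j : ℤ) (x : X.carrier),
      (∑ k ∈ t, c k • shiftUnit K X (i + k)).1 (j, x) = if j - i ∈ t then c (j - i) else 0 := by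
    intro t c j x
    classical
    induction t using Finset.induction_on with
    | empty => simp [ConvolutionAlgebra.zero_val]
    | insert a t ha ih =>
      rw [Finset.sum_insert ha, ConvolutionAlgebra.add_val, Pi.add_apply, ih,
        ConvolutionAlgebra.smul_val, Pi.smul_apply, shiftUnit, homogeneous_val]
      by_cases h : j = i + a
      · subst h
        simp [ha]
      · have h' : j - i ≠ a := by omega
        simp [h, h']
  refine ConvolutionAlgebra.ext fun j x => ?_
  rw [cutoff_mul_val, cutoff_mul_val, shiftUnit_mul_val, hsum]
  split_ifs with h₁ h₂
  · have := hv (j - i) h₂ _ h₁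
    rwa [shiftPow_shiftPow, show -(i + (j - i)) + j = 0 by omega, shiftPow_zero] at this
  · exact hs _ h₂ x
  · rfl

end Homogeneous

/-! ### Almost invariant towers -/

section Tower

variable {S : Type*} [TopologicalSpace S] [DiscreteTopology S] [Finite S]
  {K : Type*} [Field K] {X : Subshift S ℤ}

instance : CompactSpace X.carrier := isCompact_iff_compactSpace.1 X.isClosed.isCompact

omit [DiscreteTopology S] [Finite S] in
theorem eventually_apply_eq (v : ConvolutionAlgebra K X) (k n : ℤ) (x₀ : X.carrier) :
    ∀ᶠ y in 𝓝 x₀, v.1 (k, shiftPow n y) = v.1 (k, shiftPow n x₀) := by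
  have h : IsLocallyConstant fun y : X.carrier => v.1 (k, shiftPow n y) :=
    v.2.1.comp_continuous (f := fun y : X.carrier => ((k, shiftPow n y) : ActionGroupoid X))
      (continuous_const.prodMk (continuous_shiftPow n))
  exact h.eventually_eq x₀

/-- A point that `T ^ n` moves has a neighbourhood that `T ^ n` moves off itself. -/
theorem exists_nhds_shiftPow_notMem (n : ℤ) (x₀ : X.carrier) (h : shiftPow n x₀ ≠ x₀) :
    ∃ O ∈ 𝓝 x₀, ∀ y ∈ O, shiftPow n y ∉ O := by
  obtain ⟨O₁, O₂, h₁, h₂, hx₁, hx₂, hd⟩ := t2_separation h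
  refine ⟨O₂ ∩ shiftPow n ⁻¹' O₁, Filter.inter_mem (h₂.mem_nhds hx₂)
    ((continuous_shiftPow n).continuousAt.preimage_mem_nhds (h₁.mem_nhds hx₁)), ?_⟩
  exact fun y hy hy' => Set.disjoint_left.1 hd hy.2 hy'.1

/-- A point with infinite orbit is the base of arbitrarily high towers that are arbitrarily fine:
it has a clopen neighbourhood `U` that the first powers of the shift move off itself, and on whose
translates the coefficients of finitely many given elements `v` are constant. -/
theorem exists_isClopen_tower (x₀ : X.carrier) (hx₀ : ∀ n : ℤ, n ≠ 0 → shiftPow n x₀ ≠ x₀)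
    (b : Finset (ConvolutionAlgebra K X)) (s t : Finset ℤ) (n : ℕ) :
    ∃ U : Set X.carrier, IsClopen U ∧ x₀ ∈ U ∧
      (∀ v ∈ b, ∀ k ∈ s, ∀ j ∈ t, ∀ y ∈ U,
        v.1 (k, shiftPow j y) = v.1 (k, shiftPow j x₀)) ∧
      ∀ d : ℤ, d ≠ 0 → |d| < n → ∀ y ∈ U, shiftPow d y ∉ U := by
  have h₁ : ∀ᶠ y in 𝓝 x₀, ∀ v ∈ b, ∀ k ∈ s, ∀ j ∈ t,
      v.1 (k, shiftPow j y) = v.1 (k, shiftPow j x₀) := by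
    simp only [Filter.eventually_all_finset]
    exact fun v _ k _ j _ => eventually_apply_eq v k j x₀
  have h₂ : ∃ O ∈ 𝓝 x₀, ∀ d : ℤ, d ≠ 0 → |d| < n → ∀ y ∈ O, shiftPow d y ∉ O := by
    choose! O hO hd using fun (d : ℤ) (h : d ≠ 0) => exists_nhds_shiftPow_notMem d x₀ (hx₀ d h)
    refine ⟨⋂ d ∈ (Finset.Ioo (-n : ℤ) n).erase 0, O d, (Filter.biInter_finset_mem _).2
      fun d hd' => hO d (Finset.mem_erase.1 hd').1, fun d h0 hn y hy hy' => ?_⟩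
    have hmem : d ∈ (Finset.Ioo (-n : ℤ) n).erase 0 :=
      Finset.mem_erase.2 ⟨h0, Finset.mem_Ioo.2 (abs_lt.1 hn)⟩
    exact hd d h0 y (Set.mem_iInter₂.1 hy d hmem) (Set.mem_iInter₂.1 hy' d hmem)
  obtain ⟨O, hO, hd⟩ := h₂
  obtain ⟨U, ⟨hxU, hU⟩, hsub⟩ := (nhds_basis_clopen x₀).mem_iff.1 (Filter.inter_mem h₁ hO)
  exact ⟨U, hU, hxU, fun v hv k hk j hj y hy => (hsub hy).1 v hv k hk j hj,
    fun d h0 hn y hy hy' => hd d h0 hn y (hsub hy).2 (hsub hy').2⟩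

/-- The element `m T ^ i` at height `i` of the tower over `m`. -/
noncomputable def level (K : Type*) [Field K] {X : Subshift S ℤ} {M : Type*} [AddCommGroup M]
    [Module (ConvolutionAlgebra K X)ᵐᵒᵖ M] (m : M) (i : ℤ) : M :=
  MulOpposite.op (shiftUnit K X i) • m

variable {M : Type*} [AddCommGroup M] [Module K M] [Module (ConvolutionAlgebra K X)ᵐᵒᵖ M]
  [IsScalarTower K (ConvolutionAlgebra K X)ᵐᵒᵖ M]

/-- As `T ^ i U` and `T ^ j U` are disjoint for `i ≠ j`, multiplication by `T ^ (-i) e_U` maps the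
level at `i` to `m` and kills all the others, so the levels are linearly independent. -/
theorem linearIndependent_level {U : Set X.carrier} (hU : IsClopen U) (n : ℕ)
    (hd : ∀ d : ℤ, d ≠ 0 → |d| < n → ∀ y ∈ U, shiftPow d y ∉ U) {m : M} (hm : m ≠ 0)
    (hmU : MulOpposite.op (cutoff K hU) • m = m) :
    LinearIndependent K fun i : Fin n => level K (X := X) m (i : ℤ) := by
  have hproj : ∀ i j : Fin n, MulOpposite.op (shiftUnit K X (-(i : ℤ)) * cutoff K hU) •
      level K (X := X) m (j : ℤ) = if j = i then m else 0 := by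
    intro i j
    rw [level, ← mul_smul, ← MulOpposite.op_mul, ← mul_assoc, shiftUnit_mul_shiftUnit]
    split_ifs with h
    · rw [h, add_neg_cancel, shiftUnit_zero, one_mul, hmU]
    · -- For `j ≠ i` the two levels are separated by `e_U T ^ (j - i) e_U = 0`.
      conv_lhs => rw [← hmU]
      rw [← mul_smul, ← MulOpposite.op_mul, cutoff_mul_shiftUnit_mul_cutoff hU _
        (hd _ (by omega) (abs_lt.2 (by omega))), MulOpposite.op_zero, zero_smul]
  rw [Fintype.linearIndependent_iff]
  intro c hc i
  have := congrArg (MulOpposite.op (shiftUnit K X (-(i : ℤ)) * cutoff K hU) • ·) hc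
  simp only [Finset.smul_sum, op_smul_smul_comm, hproj, smul_zero, smul_ite,
    Finset.sum_ite_eq', Finset.mem_univ, if_true] at this
  exact (smul_eq_zero.1 this).resolve_right hm

theorem op_smul_level_mem {U : Set X.carrier} (hU : IsClopen U) {m : M}
    (hmU : MulOpposite.op (cutoff K hU) • m = m) (i : ℤ)
    (v : ConvolutionAlgebra K X) (s : Finset ℤ) (hs : ∀ k ∉ s, ∀ x, v.1 (k, x) = 0)
    (x₀ : X.carrier) (hv : ∀ k ∈ s, ∀ y ∈ U,
      v.1 (k, shiftPow (-(i + k)) y) = v.1 (k, shiftPow (-(i + k)) x₀))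
    (N : Submodule K M) (hN : ∀ k ∈ s, level K (X := X) m (i + k) ∈ N) :
    MulOpposite.op v • level K (X := X) m i ∈ N := by
  have h : MulOpposite.op v • level K (X := X) m i =
      ∑ k ∈ s, v.1 (k, shiftPow (-(i + k)) x₀) • level K (X := X) m (i + k) := by
    rw [level]
    conv_lhs => rw [← hmU]
    rw [← mul_smul, ← mul_smul, ← MulOpposite.op_mul, ← MulOpposite.op_mul,
      cutoff_mul_shiftUnit_mul hU i v s hs x₀ hv, MulOpposite.op_mul, mul_smul, hmU,
      Finset.op_sum, Finset.sum_smul]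
    exact Finset.sum_congr rfl fun k _ => by rw [MulOpposite.op_smul, smul_assoc, level]
  rw [h]
  exact N.sum_mem fun k hk => N.smul_mem _ (hN k hk)

/-- A module is exhaustively amenable if it has non-zero elements supported on arbitrarily small
neighbourhoods of a point with infinite orbit: the levels of a tall fine tower over such an
element span an almost invariant subspace, whose dimension outweighs that of `W`. -/
theorem isExhaustivelyAmenable_of_forall_isClopen (x₀ : X.carrier)
    (hx₀ : ∀ n : ℤ, n ≠ 0 → shiftPow n x₀ ≠ x₀)
    (hM : ∀ (U : Set X.carrier) (hU : IsClopen U), x₀ ∈ U →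
      ∃ m : M, m ≠ 0 ∧ MulOpposite.op (cutoff K hU) • m = m) :
    IsExhaustivelyAmenable K (ConvolutionAlgebra K X) M := by
  intro V hV ε hε W hW
  obtain ⟨b, hb⟩ := (Submodule.fg_iff_finiteDimensional V).2 hV
  -- The degrees of the elements of `V` lie in `[-N, N]`.
  obtain ⟨N, hN⟩ : ∃ N : ℕ, ∀ v ∈ b, ∀ k ∉ Finset.Icc (-N : ℤ) N,
      ∀ x, v.1 (k, x) = 0 := by
    choose s hs using fun v : ConvolutionAlgebra K X => exists_degrees v.2
    refine ⟨(b.biUnion s).sup Int.natAbs, fun v hv k hk => hs v k fun hks => hk ?_⟩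
    have := Finset.le_sup (f := Int.natAbs) (Finset.mem_biUnion.2 ⟨v, hv, hks⟩)
    rw [Finset.mem_Icc]
    omega
  have hWV : FiniteDimensional K (prodSpan W V) :=
    finiteDimensional_prodSpan _ _
  set C := Module.finrank K (prodSpan W V)
  -- The height is chosen so that `n + 2 N + dim (W V) < (1 + ε) n`.
  obtain ⟨n, hn⟩ := exists_nat_gt ((2 * N + C) / ε)
  rw [div_lt_iff₀ hε] at hn
  obtain ⟨U, hU, hxU, hconst, hd⟩ := exists_isClopen_tower x₀ hx₀ b (Finset.Icc (-N : ℤ) N)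
    (Finset.Icc (-(n + N : ℤ)) N) n
  obtain ⟨m, hm0, hmU⟩ := hM U hU hxU
  have hind := linearIndependent_level hU n hd hm0 hmU
  let F : Submodule K M := Submodule.span K (Set.range fun i : Fin n => level K (X := X) m (i : ℤ))
  have hF : FiniteDimensional K F := FiniteDimensional.span_of_finite K (Set.finite_range _)
  have hFn : Module.finrank K F = n := by
    rw [finrank_span_eq_card hind, Fintype.card_fin]
  classical
  let I : Finset M := (Finset.Ico (-N : ℤ) (n + N)).image fun j => level K (X := X) m j
  have hI : ∀ j : ℤ, -N ≤ j → j < n + N → level K (X := X) m j ∈ Submodule.span K (I : Set M) :=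
    fun j h₁ h₂ => Submodule.subset_span (Finset.mem_coe.2 (Finset.mem_image.2
      ⟨j, Finset.mem_Ico.2 ⟨h₁, h₂⟩, rfl⟩))
  have hIcard : Module.finrank K (Submodule.span K (I : Set M)) ≤ n + 2 * N := by
    refine (finrank_span_finset_le_card I).trans (Finset.card_image_le.trans ?_)
    rw [Int.card_Ico]
    omega
  have hle : prodSpan (F ⊔ W) V ≤
      Submodule.span K (I : Set M) ⊔ prodSpan W V := by
    refine prodSpan_le.2 fun l hl v hv => ?_
    obtain ⟨f, hf, w, hw, rfl⟩ := Submodule.mem_sup.1 hl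
    rw [smul_add]
    refine Submodule.add_mem_sup ?_ (op_smul_mem_prodSpan hw hv)
    clear hl
    induction hf using Submodule.span_induction with
    | zero => rw [smul_zero]; exact Submodule.zero_mem _
    | add x y _ _ hx hy =>
      rw [smul_add]
      exact Submodule.add_mem _ hx hy
    | smul c x _ hx =>
      rw [op_smul_smul_comm]
      exact Submodule.smul_mem _ _ hx
    | mem x hx =>
      obtain ⟨i, rfl⟩ := hx
      dsimp only
      rw [← hb] at hv
      induction hv using Submodule.span_induction with
      | zero => rw [MulOpposite.op_zero, zero_smul]; exact Submodule.zero_mem _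
      | add x y _ _ hx hy =>
        rw [MulOpposite.op_add, add_smul]
        exact Submodule.add_mem _ hx hy
      | smul c x _ hx =>
        rw [MulOpposite.op_smul, smul_assoc]
        exact Submodule.smul_mem _ _ hx
      | mem v hv =>
        refine op_smul_level_mem hU hmU i v _ (hN v hv) x₀ (fun k hk => ?_) _ fun k hk => ?_
        · refine hconst v hv k hk _ ?_
          rw [Finset.mem_Icc] at hk ⊢
          omega
        · rw [Finset.mem_Icc] at hk
          exact hI _ (by omega) (by omega)
  refine ⟨F ⊔ W, le_sup_right, inferInstance, ?_⟩
  have h₁ : Module.finrank K (prodSpan (F ⊔ W) V) ≤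
      n + 2 * N + C :=
    (Submodule.finrank_mono hle).trans
      ((Submodule.finrank_add_le_finrank_add_finrank _ _).trans (Nat.add_le_add_right hIcard _))
  have h₂ : n ≤ Module.finrank K ↥(F ⊔ W) := hFn ▸ Submodule.finrank_mono le_sup_left
  calc (Module.finrank K (prodSpan (F ⊔ W) V) : ℝ)
      ≤ n + 2 * N + C := by exact_mod_cast h₁
    _ < (1 + ε) * n := by linarith
    _ ≤ (1 + ε) * Module.finrank K ↥(F ⊔ W) := by gcongr

end Tower

/-! ### Modules over minimal subshifts -/

section Minimal

variable {S : Type*} [TopologicalSpace S] [DiscreteTopology S] [Finite S]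
  {K : Type*} [Field K] {X : Subshift S ℤ}

omit [DiscreteTopology S] [Finite S] in
/-- In a minimal subshift, every orbit visits every non-empty open set. -/
theorem IsMinimal.exists_shiftPow_mem (hX : IsMinimal X) {U : Set X.carrier} (hU : IsOpen U)
    (hne : U.Nonempty) (x : X.carrier) : ∃ n : ℤ, shiftPow n x ∈ U := by
  let Y : Subshift S ℤ :=
    { carrier := closure (Set.range fun n : ℤ => shift n x.1)
      isClosed := isClosed_closure
      mapsTo := fun g => by
        refine Set.MapsTo.closure ?_ (continuous_shift g)
        rintro _ ⟨n, rfl⟩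
        exact ⟨n + g, shift_add n g x.1⟩ }
  have hYX : Y.carrier ⊆ X.carrier :=
    closure_minimal (Set.range_subset_iff.2 fun n => X.mapsTo n x.2) X.isClosed
  have hY : Y.carrier = X.carrier :=
    hX.2 Y ⟨shift 0 x.1, subset_closure ⟨0, rfl⟩⟩ hYX
  obtain ⟨u, hu⟩ := hne
  obtain ⟨O, hO, rfl⟩ := isOpen_induced_iff.1 hU
  have hmem : u.1 ∈ Y.carrier := hY.symm.subset u.2
  obtain ⟨_, hz, n, rfl⟩ := mem_closure_iff.1 hmem O hO hu
  exact ⟨n, hz⟩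

/-- Over a minimal subshift, every non-zero module has a non-zero element supported on any given
non-empty clopen set `U`: finitely many translates of `U` cover `X`, so the idempotents of these
translates cannot all kill a given non-zero element. -/
theorem IsMinimal.exists_cutoff_smul_eq (hX : IsMinimal X) {M : Type*} [AddCommGroup M]
    [Module (ConvolutionAlgebra K X)ᵐᵒᵖ M] [Nontrivial M] {U : Set X.carrier} (hU : IsClopen U)
    (hne : U.Nonempty) : ∃ m : M, m ≠ 0 ∧ MulOpposite.op (cutoff K hU) • m = m := by
  obtain ⟨m, hm⟩ := exists_ne (0 : M)
  obtain ⟨n, hn⟩ : ∃ n : ℤ, MulOpposite.op (shiftUnit K X n * cutoff K hU) • m ≠ 0 := by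
    by_contra! h
    have hkill : ∃ (C : Set X.carrier) (hC : IsClopen C), Set.univ ⊆ C ∧
        MulOpposite.op (cutoff K hC) • m = 0 := by
      refine isCompact_univ.induction_on
        (p := fun A => ∃ (C : Set X.carrier) (hC : IsClopen C), A ⊆ C ∧
          MulOpposite.op (cutoff K hC) • m = 0) ?_ ?_ ?_ ?_
      · exact ⟨∅, isClopen_empty, subset_rfl, by
          rw [cutoff_empty, MulOpposite.op_zero, zero_smul]⟩
      · rintro A B hAB ⟨C, hC, hBC, h0⟩
        exact ⟨C, hC, hAB.trans hBC, h0⟩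
      · rintro A B ⟨C, hC, hAC, h0⟩ ⟨D, hD, hBD, h1⟩
        refine ⟨C ∪ D, hC.union hD, Set.union_subset_union hAC hBD, ?_⟩
        rw [cutoff_union hC hD, MulOpposite.op_sub, MulOpposite.op_add, sub_smul, add_smul,
          MulOpposite.op_mul, mul_smul, h0, h1, smul_zero, add_zero, sub_zero]
      · intro x _
        obtain ⟨n, hn⟩ := hX.exists_shiftPow_mem hU.isOpen hne x
        rw [← neg_neg n] at hn
        refine ⟨_, mem_nhdsWithin_of_mem_nhds
          ((hU.preimage (continuous_shiftPow (- -n))).isOpen.mem_nhds hn), _,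
          hU.preimage (continuous_shiftPow (- -n)), subset_rfl, ?_⟩
        rw [← shiftUnit_mul_cutoff_mul_shiftUnit hU, ← mul_assoc, MulOpposite.op_mul, mul_smul, h,
          smul_zero]
    obtain ⟨C, hC, hCu, h0⟩ := hkill
    obtain rfl : C = Set.univ := Set.univ_subset_iff.1 hCu
    rw [cutoff_univ, MulOpposite.op_one, one_smul] at h0
    exact hm h0
  refine ⟨_, hn, ?_⟩
  rw [← mul_smul, ← MulOpposite.op_mul, mul_assoc, cutoff_mul_self]

end Minimal

end ExhAmen

theorem theorem1p2 {K : Type*} [Field K]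
    {S : Type*} [TopologicalSpace S] [DiscreteTopology S] [Finite S]
    (X : SymbolicDynamics.FullShift.Subshift S ℤ)
    (htrans : ExhAmen.IsTransitive X) (haper : ExhAmen.IsAperiodic X) :
    (ExhAmen.IsExhaustivelyAmenable K
        (ExhAmen.MonomialAlgebra K X) (ExhAmen.MonomialAlgebra K X) →
      ExhAmen.IsExhaustivelyAmenable K
        (ExhAmen.ConvolutionAlgebra K X) (ExhAmen.ConvolutionAlgebra K X)) ∧
    (ExhAmen.IsMinimal X →
      ∀ (M : Type*) [AddCommGroup M] [Module K M] [Module (ExhAmen.ConvolutionAlgebra K X)ᵐᵒᵖ M]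
        [IsScalarTower K (ExhAmen.ConvolutionAlgebra K X)ᵐᵒᵖ M] [Nontrivial M],
        ExhAmen.IsExhaustivelyAmenable K (ExhAmen.ConvolutionAlgebra K X) M) := by
  obtain ⟨x, hx, hper⟩ := haper
  have hx₀ : ∀ n : ℤ, n ≠ 0 → ExhAmen.shiftPow n (⟨x, hx⟩ : X.carrier) ≠ ⟨x, hx⟩ :=
    fun n hn h => hper n hn (congrArg Subtype.val h)
  refine ⟨fun _ => ?_, fun hmin M _ _ _ _ _ => ?_⟩
  · refine ExhAmen.isExhaustivelyAmenable_of_forall_isClopen ⟨x, hx⟩ hx₀ fun U hU hxU =>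
      ⟨ExhAmen.cutoff K hU, fun h => ?_, ExhAmen.cutoff_mul_self hU⟩
    have := ExhAmen.cutoff_val (K := K) hU 0 ⟨x, hx⟩
    rw [h, if_pos ⟨rfl, hxU⟩] at this
    exact zero_ne_one this
  · exact ExhAmen.isExhaustivelyAmenable_of_forall_isClopen ⟨x, hx⟩ hx₀ fun U hU hxU =>
      hmin.exists_cutoff_smul_eq hU ⟨_, hxU⟩
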